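/- Let $n,m\ge 1$ be integers. For a bipartite graph with left nodes $u_1,\dots,u_n$ and $m$ right nodes, let $N(S)$ be the set of right nodes adjacent to a node of the set $S$ of left nodes. The greedy algorithm starts with $G_0=\emptyset$ and, for $t=1,\dots,n$, sets $G_t=G_{t-1}\cup\{u\}$, where $u\notin G_{t-1}$ maximizes the marginal contribution $|N(u)\setminus N(G_{t-1})|$ among the left nodes outside $G_{t-1}$, ties being broken in favor of the smallest index (that is, the left nodes are indexed in the order in which greedy breaks ties). For $d\ge 1$, let $$t_d=\max\{1\le t\le n : |N(G_t)\setminus N(G_{t-1})|=d\}$$ be the last iteration whose marginal contribution is $d$. Below, every left node chooses, independently of the others, its neighborhood uniformly at random among the sets of exactly $d$ right nodes, so that $t_d$ is the number of iterations with full marginal contribution $d$. 1. (Left-regular random model, $m=n$.) Let $d\ge 1$ be an integer with $d\le\sqrt{n/2}$, let the random graph have $n$ left and $n$ right nodes, and let $$t^*_d=\left(1-\bigl(1+d(d-1)\bigr)^{-\frac1{d-1}}\right)\cdot\frac nd .$$ Then, with probability at least $1-\frac1n$, $$|t_d-t^*_d|\le 3e^{d^2}\sqrt{8n\log(2n)}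 .$$ 2. (General $m$.) Let $d\ge 1$ be an integer with $m\ge 2d^2$, let the random graph have $n$ left and $m$ right nodes, and let $$t^*_d=\left(1-\Bigl(1+\frac{nd(d-1)}{m}\Bigr)^{-\frac1{d-1}}\right)\cdot\frac md .$$ Then, with probability at least $1-\frac1n$, $$|t_d-t^*_d|\le 3e^{nd^2/m}\sqrt{8n\log(2n)} .$$ For $d=1$, where the exponent $-\frac1{d-1}$ is undefined, the formulas for $t^*_d$ are read as their limits for $d\to1$: $t^*_1=(1-e^{-1})\,n$ in part 1 and $t^*_1=(1-e^{-n/m})\,m$ in part 2. -/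

import Mathlib

open MeasureTheory ProbabilityTheory

namespace MaxCoverage

/-- A bipartite graph with left nodes `u_0, …, u_{n-1}` and right nodes `v_0, …, v_{m-1}`,
given by the neighborhood of each left node. -/
abbrev BipGraph (n m : ℕ) : Type := Fin n → Finset (Fin m)

/-- The law of the random bipartite graph with `n` left and `m` right nodes in which the left nodes
choose their neighborhoods independently, and the neighborhood of `u_i` is uniform among the sets
of exactly `d i` right nodes. -/
noncomputable def genR (n m : ℕ) (d : Fin n → ℕ) : Measure (BipGraph n m) :=
  Measure.pi fun i => uniformOn {s : Finset (Fin m) | s.card = d i}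

/-- The left-regular random model: `n` left nodes, `n` right nodes, all left degrees `d`. -/
noncomputable def lrr (n d : ℕ) : Measure (BipGraph n n) :=
  genR n n fun _ => d

variable {n m : ℕ}

/-- The set of right nodes adjacent to a node of `S`. -/
def neighbors (B : BipGraph n m) (S : Finset (Fin n)) : Finset (Fin m) :=
  S.biUnion B

/-- The marginal contribution of `u` to `S`. -/
def gain (B : BipGraph n m) (S : Finset (Fin n)) (u : Fin n) : ℕ :=
  (B u \ neighbors B S).card

/-- The left nodes outside `S` of largest marginal contribution to `S`. -/
def bestNodes (B : BipGraph n m) (S : Finset (Fin n)) : Finset (Fin n) :=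
  {u ∈ Sᶜ | ∀ v ∈ Sᶜ, gain B S v ≤ gain B S u}

/-- One iteration of greedy: add a node of largest marginal contribution, ties being broken in
favor of the smallest index. (Once all the left nodes are taken, nothing happens.) -/
def greedyStep (B : BipGraph n m) (S : Finset (Fin n)) : Finset (Fin n) :=
  if h : (bestNodes B S).Nonempty then insert ((bestNodes B S).min' h) S else S

/-- The greedy solution after `k` iterations. -/
def greedy (B : BipGraph n m) : ℕ → Finset (Fin n)
  | 0 => ∅
  | k + 1 => greedyStep B (greedy B k)

/-- The last iteration `t ∈ {1, …, n}` of greedy with marginal contribution exactly `d`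
(`0` if there is none). -/
def lastFullStep (B : BipGraph n m) (d : ℕ) : ℕ :=
  {t ∈ Finset.Icc 1 n |
    (neighbors B (greedy B t) \ neighbors B (greedy B (t - 1))).card = d}.sup id

/-- The estimate of `t_d` for `n` left and `m` right nodes. At `d = 1`, where the exponent
`-1 / (d - 1)` has no value, it is the limit of the general formula as `d → 1`. -/
noncomputable def estimateGen (n m d : ℕ) : ℝ :=
  if d = 1 then (1 - Real.exp (-((n : ℝ) / m))) * m
  else (1 - (1 + (n : ℝ) * d * (d - 1) / m) ^ (-(1 / ((d : ℝ) - 1)))) * (m / d)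

/-- The estimate of `t_d` for `n` left and `n` right nodes, with the same convention at `d = 1`. -/
noncomputable def estimate (n d : ℕ) : ℝ :=
  if d = 1 then (1 - Real.exp (-1)) * n
  else (1 - (1 + (d : ℝ) * (d - 1)) ^ (-(1 / ((d : ℝ) - 1)))) * (n / d)

end MaxCoverage

/-! When all left degrees equal `d`, a full contribution means a neighborhood disjoint from
everything covered. A node that fails this test fails it forever, since coverage only grows. With
ties broken by index, greedy's full iterations therefore take exactly the nodes accepted in one pass
over the indices, and `t_d` is the number of accepted nodes (`lastFullStep_eq_card_scan`).

Let `Z_k` be the number accepted among the first `k`. Given the past, the next node is accepted with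
probability `freeProb m d Z_k`, which is close to `(1 - d Z_k / m) ^ d`. So `Z` should follow `y' =
(1 - d y / m) ^ d`, `y 0 = 0`, whose solution at time `n` is the estimate. Azuma's inequality and a
union bound keep the martingale part of `Z` below `c = √(8 n log (2n))` at all times, except with
probability at most `1/n`. A discrete Gronwall argument (`abs_sub_limitTaken_le`) turns this into
the error `(c + 3K) e^K`, with `K = n d² / m`. This is at most `3 c e^K` unless `K` is so large that
the trivial bound `n` suffices. -/

namespace MaxCoverage

/-! ### Greedy on left-regular graphs as a single pass -/

section Scan

variable {n m : ℕ}

/-- Scan the left nodes in order of index, and take a node when its neighborhood is disjoint from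
what the nodes taken before it cover: the nodes taken among the first `i`. -/
def scan (B : BipGraph n m) : ℕ → Finset (Fin n)
  | 0 => ∅
  | i + 1 =>
    if h : i < n then
      if Disjoint (B ⟨i, h⟩) (neighbors B (scan B i)) then insert ⟨i, h⟩ (scan B i) else scan B i
    else scan B i

lemma scan_succ (B : BipGraph n m) {i : ℕ} (h : i < n) :
    scan B (i + 1) = if Disjoint (B ⟨i, h⟩) (neighbors B (scan B i)) then
      insert ⟨i, h⟩ (scan B i) else scan B i := by
  simp [scan, h]

lemma lt_of_mem_scan (B : BipGraph n m) (i : ℕ) {u : Fin n} (hu : u ∈ scan B i) : (u : ℕ) < i := by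
  induction i with
  | zero => simp [scan] at hu
  | succ i ih =>
    rw [scan] at hu
    split_ifs at hu with h1 h2
    · rcases Finset.mem_insert.1 hu with rfl | h
      · simp
      · exact (ih h).trans i.lt_succ_self
    · exact (ih hu).trans i.lt_succ_self
    · exact (ih hu).trans i.lt_succ_self

lemma neighbors_mono (B : BipGraph n m) {S T : Finset (Fin n)} (h : S ⊆ T) :
    neighbors B S ⊆ neighbors B T :=
  Finset.biUnion_subset_biUnion_of_subset_left _ h

lemma neighbors_insert (B : BipGraph n m) (S : Finset (Fin n)) (u : Fin n) :
    neighbors B (insert u S) = B u ∪ neighbors B S := by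
  simp [neighbors, Finset.biUnion_insert]

lemma scan_subset_scan_succ (B : BipGraph n m) (i : ℕ) : scan B i ⊆ scan B (i + 1) := by
  rw [scan]
  split_ifs with h1 h2
  · exact Finset.subset_insert _ _
  · exact Finset.Subset.refl _
  · exact Finset.Subset.refl _

lemma not_disjoint_of_notMem_scan (B : BipGraph n m) (i : ℕ) {u : Fin n} (hi : (u : ℕ) < i)
    (hu : u ∉ scan B i) : ¬ Disjoint (B u) (neighbors B (scan B i)) := by
  induction i with
  | zero => simp at hi
  | succ i ih =>
    intro hd
    have hd' : Disjoint (B u) (neighbors B (scan B i)) :=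
      hd.mono_right (neighbors_mono B (scan_subset_scan_succ B i))
    have hu' : u ∉ scan B i := fun h => hu (scan_subset_scan_succ B i h)
    rcases Nat.lt_succ_iff_lt_or_eq.1 hi with h | h
    · exact ih h hu' hd'
    · subst h
      rw [scan_succ B u.2, if_pos hd'] at hu
      exact hu (Finset.mem_insert_self _ _)

/-- Adaptedness: the state before index `i` is independent of the neighborhoods still to come. -/
lemma scan_congr {B B' : BipGraph n m} (i : ℕ) (h : ∀ u : Fin n, (u : ℕ) < i → B u = B' u) :
    scan B i = scan B' i ∧ neighbors B (scan B i) = neighbors B' (scan B' i) := by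
  have hN : ∀ i, (∀ u : Fin n, (u : ℕ) < i → B u = B' u) → scan B i = scan B' i →
      neighbors B (scan B i) = neighbors B' (scan B' i) := by
    intro i h e
    rw [← e]
    exact Finset.biUnion_congr rfl fun u hu => h u (lt_of_mem_scan B i hu)
  suffices e : scan B i = scan B' i from ⟨e, hN i h e⟩
  induction i with
  | zero => rfl
  | succ i ih =>
    have h' : ∀ u : Fin n, (u : ℕ) < i → B u = B' u := fun u hu => h u (hu.trans i.lt_succ_self)
    have e := ih h'
    by_cases hi : i < n
    · rw [scan_succ B hi, scan_succ B' hi, hN i h' e, h ⟨i, hi⟩ i.lt_succ_self, e]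
    · simp [scan, hi, e]

lemma card_neighbors_scan {B : BipGraph n m} {d : ℕ} (hB : ∀ u, (B u).card = d) (i : ℕ) :
    (neighbors B (scan B i)).card = d * (scan B i).card := by
  induction i with
  | zero => simp [scan, neighbors]
  | succ i ih =>
    by_cases hi : i < n
    · rw [scan_succ B hi]
      split_ifs with h
      · rw [neighbors_insert, Finset.card_union_of_disjoint h, hB, ih,
          Finset.card_insert_of_notMem fun h' => absurd (lt_of_mem_scan B i h') (lt_irrefl _)]
        ring
      · exact ih
    · simp [scan, hi, ih]

lemma gain_le {B : BipGraph n m} {d : ℕ} (hB : ∀ u, (B u).card = d) (S : Finset (Fin n))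
    (u : Fin n) : gain B S u ≤ d :=
  (Finset.card_le_card Finset.sdiff_subset).trans (hB u).le

lemma gain_eq_iff {B : BipGraph n m} {d : ℕ} (hB : ∀ u, (B u).card = d) (S : Finset (Fin n))
    (u : Fin n) : gain B S u = d ↔ Disjoint (B u) (neighbors B S) := by
  rw [gain, ← hB u]
  constructor
  · intro h
    exact Finset.sdiff_eq_self_iff_disjoint.1 (Finset.eq_of_subset_of_card_le
      Finset.sdiff_subset h.ge)
  · intro h
    rw [Finset.sdiff_eq_self_of_disjoint h]

/-- A gain of `d` is maximal, and every smaller index outside the scan was rejected, so its gain is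
below `d`; hence the tie-break selects `i`. -/
lemma greedyStep_scan {B : BipGraph n m} {d : ℕ} (hB : ∀ u, (B u).card = d) {i : ℕ} (hi : i < n)
    (h : Disjoint (B ⟨i, hi⟩) (neighbors B (scan B i))) :
    greedyStep B (scan B i) = insert ⟨i, hi⟩ (scan B i) := by
  have hn : (⟨i, hi⟩ : Fin n) ∉ scan B i :=
    fun h' => absurd (lt_of_mem_scan B i h') (lt_irrefl _)
  have hmem : (⟨i, hi⟩ : Fin n) ∈ bestNodes B (scan B i) := by
    simp only [bestNodes, Finset.mem_filter, Finset.mem_compl]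
    refine ⟨hn, fun v _ => ?_⟩
    rw [(gain_eq_iff hB _ _).2 h]
    exact gain_le hB _ _
  have hne : (bestNodes B (scan B i)).Nonempty := ⟨_, hmem⟩
  rw [greedyStep, dif_pos hne]
  congr 1
  refine le_antisymm (Finset.min'_le _ _ hmem) (Finset.le_min' _ _ _ fun v hv => ?_)
  simp only [bestNodes, Finset.mem_filter, Finset.mem_compl] at hv
  by_contra hlt
  have hg := hv.2 _ hn
  rw [(gain_eq_iff hB _ _).2 h] at hg
  exact not_disjoint_of_notMem_scan B i (not_le.1 hlt) hv.1
    ((gain_eq_iff hB _ _).1 ((gain_le hB _ _).antisymm hg))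

/-- Rejected indices cost greedy no iteration, so the greedy clock is the number of accepted nodes.
-/
lemma greedy_card_scan {B : BipGraph n m} {d : ℕ} (hB : ∀ u, (B u).card = d) (i : ℕ) :
    greedy B (scan B i).card = scan B i ∧ (0 < (scan B i).card →
      (neighbors B (greedy B (scan B i).card) \
        neighbors B (greedy B ((scan B i).card - 1))).card = d) := by
  induction i with
  | zero => simp [scan, greedy]
  | succ i ih =>
    by_cases hi : i < n
    · rw [scan_succ B hi]
      split_ifs with h
      · have hn : (⟨i, hi⟩ : Fin n) ∉ scan B i :=
          fun h' => absurd (lt_of_mem_scan B i h') (lt_irrefl _)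
        rw [Finset.card_insert_of_notMem hn, Nat.add_sub_cancel, greedy, ih.1,
          greedyStep_scan hB hi h]
        refine ⟨rfl, fun _ => ?_⟩
        rw [neighbors_insert, Finset.union_sdiff_right]
        exact (gain_eq_iff hB _ _).2 h
      · exact ih
    · simpa [scan, hi] using ih

lemma subset_greedyStep (B : BipGraph n m) (S : Finset (Fin n)) : S ⊆ greedyStep B S := by
  rw [greedyStep]
  split_ifs
  · exact Finset.subset_insert _ _
  · exact Finset.Subset.refl _

lemma greedy_mono (B : BipGraph n m) : Monotone (greedy B) :=
  monotone_nat_of_le_succ fun k => subset_greedyStep B (greedy B k)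

/-- In a left-regular graph, the iterations of greedy with full marginal contribution are the nodes
taken by the scan. -/
lemma lastFullStep_eq_card_scan {B : BipGraph n m} {d : ℕ} (hd : 1 ≤ d)
    (hB : ∀ u, (B u).card = d) : lastFullStep B d = (scan B n).card := by
  rw [lastFullStep]
  apply le_antisymm
  · refine Finset.sup_le fun t ht => ?_
    simp only [Finset.mem_filter, Finset.mem_Icc] at ht
    by_contra hlt
    rw [id, not_le] at hlt
    obtain ⟨t, rfl⟩ : ∃ s, t = s + 1 := ⟨t - 1, by omega⟩
    -- Once greedy contains the whole scan, every remaining node meets the covered set, so no later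
    -- gain can be `d`.
    have hsub : scan B n ⊆ greedy B t := by
      rw [← (greedy_card_scan hB n).1]
      exact greedy_mono B (by omega)
    have h := ht.2
    rw [Nat.add_sub_cancel, greedy, greedyStep] at h
    split_ifs at h with hne
    · rw [neighbors_insert, Finset.union_sdiff_right] at h
      have hu := Finset.min'_mem _ hne
      have hu' := Finset.mem_compl.1 (Finset.mem_filter.1 hu).1
      exact not_disjoint_of_notMem_scan B n (Fin.is_lt _) (fun h' => hu' (hsub h'))
        (((gain_eq_iff hB _ _).1 h).mono_right (neighbors_mono B hsub))
    · rw [Finset.sdiff_self, Finset.card_empty] at h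
      omega
  · rcases Nat.eq_zero_or_pos (scan B n).card with h | h
    · simp [h]
    · refine Finset.le_sup (f := id) (b := (scan B n).card) ?_
      simp only [Finset.mem_filter, Finset.mem_Icc]
      exact ⟨⟨h, (Finset.card_le_univ _).trans (by simp)⟩, (greedy_card_scan hB n).2 h⟩

end Scan

/-! ### The limiting differential equation -/

/-- The fraction of right nodes not covered at time `t` in the continuous limit. -/
noncomputable def uncovered (m d : ℕ) (t : ℝ) : ℝ :=
  if d = 1 then Real.exp (-(t / m))
  else (1 + t * d * (d - 1) / m) ^ (-(1 / ((d : ℝ) - 1)))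

lemma estimateGen_eq (n m d : ℕ) :
    estimateGen n m d = (1 - uncovered m d n) * (m / d) := by
  unfold estimateGen uncovered
  split_ifs with h
  · simp [h]
  · rfl

lemma uncovered_zero (m d : ℕ) : uncovered m d 0 = 1 := by
  unfold uncovered
  split_ifs <;> simp

lemma uncovered_base_pos {m d : ℕ} (hd : 1 ≤ d) {t : ℝ} (ht : 0 ≤ t) :
    1 ≤ 1 + t * d * (d - 1) / m := by
  have h1 : (1 : ℝ) ≤ d := by exact_mod_cast hd
  have : 0 ≤ t * d * ((d : ℝ) - 1) / m := by
    have := sub_nonneg.2 h1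
    positivity
  linarith

lemma uncovered_pos {m d : ℕ} (hd : 1 ≤ d) {t : ℝ} (ht : 0 ≤ t) : 0 < uncovered m d t := by
  unfold uncovered
  split_ifs
  · positivity
  · exact Real.rpow_pos_of_pos (zero_lt_one.trans_le (uncovered_base_pos hd ht)) _

lemma uncovered_le_one {m d : ℕ} (hd : 1 ≤ d) {t : ℝ} (ht : 0 ≤ t) : uncovered m d t ≤ 1 := by
  unfold uncovered
  have h1 : (1 : ℝ) ≤ d := by exact_mod_cast hd
  split_ifs
  · rw [Real.exp_le_one_iff]
    have : 0 ≤ t / m := by positivity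
    linarith
  · refine Real.rpow_le_one_of_one_le_of_nonpos (uncovered_base_pos hd ht) ?_
    have := one_div_nonneg.2 (sub_nonneg.2 h1)
    linarith

lemma hasDerivAt_uncovered {m d : ℕ} (hm : 0 < m) (hd : 1 ≤ d) {t : ℝ} (ht : 0 ≤ t) :
    HasDerivAt (uncovered m d) (-(d / m) * uncovered m d t ^ d) t := by
  have hm' : (m : ℝ) ≠ 0 := by positivity
  by_cases h : d = 1
  · subst h
    have e : uncovered m 1 = fun t => Real.exp (-(t / m)) := by
      funext t
      simp [uncovered]
    rw [e]
    have := (((hasDerivAt_id t).div_const (m : ℝ)).neg).exp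
    refine this.congr_deriv ?_
    simp
    ring
  · have e : uncovered m d = fun t : ℝ =>
        (1 + t * d * (d - 1) / m) ^ (-(1 / ((d : ℝ) - 1))) := by
      funext t
      simp [uncovered, h]
    have hd1 : (d : ℝ) - 1 ≠ 0 := by
      rw [sub_ne_zero]
      exact_mod_cast h
    have hb := zero_lt_one.trans_le (uncovered_base_pos (m := m) hd ht)
    rw [e]
    have h1 : HasDerivAt (fun t : ℝ => 1 + t * d * (d - 1) / m) (d * (d - 1) / m) t := by
      have := (((((hasDerivAt_id t).mul_const (d : ℝ)).mul_const ((d : ℝ) - 1)).div_const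
        (m : ℝ)).const_add 1)
      simpa using this
    refine (h1.rpow_const (Or.inl hb.ne')).congr_deriv ?_
    beta_reduce
    rw [← Real.rpow_natCast, ← Real.rpow_mul hb.le]
    have : -(1 / ((d : ℝ) - 1)) - 1 = -(1 / ((d : ℝ) - 1)) * d := by
      field_simp
      ring
    rw [this]
    field_simp

lemma abs_pow_sub_pow_le_mul {a b : ℝ} (ha : 0 ≤ a) (ha' : a ≤ 1) (hb : 0 ≤ b) (hb' : b ≤ 1)
    (d : ℕ) : |a ^ d - b ^ d| ≤ d * |a - b| := by
  refine (abs_pow_sub_pow_le a b d).trans ?_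
  have : max |a| |b| ^ (d - 1) ≤ 1 := by
    refine pow_le_one₀ (by positivity) (max_le ?_ ?_)
    · rwa [abs_of_nonneg ha]
    · rwa [abs_of_nonneg hb]
  calc |a - b| * d * max |a| |b| ^ (d - 1) ≤ |a - b| * d * 1 := by gcongr
    _ = d * |a - b| := by ring

/-- The number of nodes taken up to time `t` in the continuous limit. -/
noncomputable def limitTaken (m d : ℕ) (t : ℝ) : ℝ := (1 - uncovered m d t) * (m / d)

/-- By the mean value theorem and the equation `u' = -(d/m) u ^ d`, the increment is exactly `u c ^
d` for some `c` in `(t, t + 1)`. -/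
lemma limitTaken_step {m d : ℕ} (hm : 0 < m) (hd : 1 ≤ d) {t : ℝ} (ht : 0 ≤ t) :
    0 ≤ limitTaken m d (t + 1) - limitTaken m d t ∧
    limitTaken m d (t + 1) - limitTaken m d t ≤ 1 ∧
    |limitTaken m d (t + 1) - limitTaken m d t - uncovered m d t ^ d| ≤ (d : ℝ) ^ 2 / m := by
  have hm' : (0 : ℝ) < m := by positivity
  have hd' : (0 : ℝ) < d := by positivity
  have mvt : ∀ b, t < b → ∃ c ∈ Set.Ioo t b,
      uncovered m d b - uncovered m d t = -(d / m) * uncovered m d c ^ d * (b - t) := by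
    intro b hb
    obtain ⟨c, hc, h⟩ := exists_hasDerivAt_eq_slope (uncovered m d)
      (fun t => -(d / m) * uncovered m d t ^ d) hb
      (fun x hx => (hasDerivAt_uncovered hm hd (ht.trans hx.1)).continuousAt.continuousWithinAt)
      (fun x hx => hasDerivAt_uncovered hm hd (ht.trans hx.1.le))
    refine ⟨c, hc, ?_⟩
    rw [h, div_mul_cancel₀ _ (sub_pos.2 hb).ne']
  obtain ⟨c, hc, h⟩ := mvt (t + 1) (by linarith)
  have hc0 : 0 ≤ c := ht.trans hc.1.le
  have e : limitTaken m d (t + 1) - limitTaken m d t = uncovered m d c ^ d := by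
    have : limitTaken m d (t + 1) - limitTaken m d t =
        -(uncovered m d (t + 1) - uncovered m d t) * (m / d) := by
      unfold limitTaken
      ring
    rw [this, h]
    field_simp
    ring
  have p0 := (uncovered_pos (m := m) hd hc0).le
  have p1 := uncovered_le_one (m := m) hd hc0
  refine ⟨e ▸ by positivity, e ▸ pow_le_one₀ p0 p1, ?_⟩
  rw [e]
  -- A second mean value step gives `|u c - u t| ≤ d / m`; the power costs another factor `d`.
  obtain ⟨c', hc', h'⟩ := mvt c hc.1
  have q0 := (uncovered_pos (m := m) hd (ht.trans hc'.1.le)).le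
  have q1 := pow_le_one₀ q0 (uncovered_le_one (m := m) hd (ht.trans hc'.1.le)) (n := d)
  refine (abs_pow_sub_pow_le_mul p0 p1 (uncovered_pos hd ht).le (uncovered_le_one hd ht) d).trans ?_
  have hle : |uncovered m d c - uncovered m d t| ≤ d / m := by
    rw [h', abs_mul, abs_mul, abs_neg, abs_of_pos (sub_pos.2 hc.1), abs_of_nonneg (pow_nonneg q0 d),
      abs_of_pos (by positivity)]
    have : c - t ≤ 1 := by linarith [hc.2]
    calc (d : ℝ) / m * uncovered m d c' ^ d * (c - t) ≤ d / m * 1 * 1 := by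
          gcongr
          linarith [hc.1]
      _ = d / m := by ring
  calc (d : ℝ) * |uncovered m d c - uncovered m d t| ≤ d * (d / m) := by gcongr
    _ = d ^ 2 / m := by ring

lemma limitTaken_zero (m d : ℕ) : limitTaken m d 0 = 0 := by
  simp [limitTaken, uncovered_zero]

lemma limitTaken_mem {m d : ℕ} (hm : 0 < m) (hd : 1 ≤ d) (k : ℕ) :
    0 ≤ limitTaken m d k ∧ limitTaken m d k ≤ k := by
  induction k with
  | zero => simp [limitTaken_zero]
  | succ k ih =>
    obtain ⟨h1, h2, -⟩ := limitTaken_step hm hd (Nat.cast_nonneg (α := ℝ) k)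
    push_cast
    constructor <;> linarith [ih.1, ih.2]

/-! ### The acceptance probability and its approximation -/

/-- The probability that a random set of `d` right nodes avoids `d * z` given ones. -/
noncomputable def freeProb (m d z : ℕ) : ℝ := ((m - d * z).choose d : ℝ) / (m.choose d : ℝ)

lemma freeProb_eq_prod (m d z : ℕ) :
    freeProb m d z = ∏ k ∈ Finset.range d, (((m - d * z - k : ℕ) : ℝ) / ((m - k : ℕ) : ℝ)) := by
  rw [Finset.prod_div_distrib]
  have h1 := Nat.descFactorial_eq_factorial_mul_choose (m - d * z) d
  have h2 := Nat.descFactorial_eq_factorial_mul_choose m d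
  rw [Nat.descFactorial_eq_prod_range] at h1 h2
  rw [← Nat.cast_prod, ← Nat.cast_prod, h1, h2, freeProb]
  push_cast
  rw [mul_div_mul_left]
  exact_mod_cast d.factorial_ne_zero

lemma freeProb_nonneg (m d z : ℕ) : 0 ≤ freeProb m d z := by
  unfold freeProb
  positivity

lemma freeProb_le_one (m d z : ℕ) : freeProb m d z ≤ 1 := by
  unfold freeProb
  refine div_le_one_of_le₀ ?_ (by positivity)
  exact_mod_cast Nat.choose_le_choose d (Nat.sub_le _ _)

/-- The factors are replaced by `a` one at a time; each exchange costs at most `c` because all other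
factors lie in `[0, 1]`. -/
lemma abs_prod_sub_pow_le {f : ℕ → ℝ} {a c : ℝ} (ha : 0 ≤ a) (ha' : a ≤ 1) (d : ℕ)
    (hf : ∀ k < d, 0 ≤ f k ∧ f k ≤ 1 ∧ |f k - a| ≤ c) :
    |∏ k ∈ Finset.range d, f k - a ^ d| ≤ d * c := by
  induction d with
  | zero => simp
  | succ d ih =>
    have h := ih fun k hk => hf k (hk.trans d.lt_succ_self)
    obtain ⟨h0, h1, h2⟩ := hf d d.lt_succ_self
    rw [Finset.prod_range_succ, pow_succ]
    have e : (∏ k ∈ Finset.range d, f k) * f d - a ^ d * a =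
        (∏ k ∈ Finset.range d, f k - a ^ d) * f d + a ^ d * (f d - a) := by ring
    rw [e]
    refine (abs_add_le _ _).trans ?_
    rw [abs_mul, abs_mul, abs_of_nonneg h0, abs_of_nonneg (pow_nonneg ha d)]
    have t1 := mul_le_mul h h1 h0 ((abs_nonneg _).trans h)
    have t2 := mul_le_mul (pow_le_one₀ ha ha' (n := d)) h2 (abs_nonneg _) zero_le_one
    push_cast
    linarith

lemma abs_freeProb_sub_le {m d z : ℕ} (hd : 1 ≤ d) (hm : 2 * d ^ 2 ≤ m) (hz : d * z ≤ m) :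
    |freeProb m d z - (1 - (d * z : ℝ) / m) ^ d| ≤ 2 * ((d : ℝ) ^ 2 / m) := by
  have hdm : 2 * d ≤ m := by nlinarith
  have hm0 : (0 : ℝ) < m := by
    have : 0 < m := by omega
    exact_mod_cast this
  have hzr : (d * z : ℝ) ≤ m := by exact_mod_cast hz
  have hdmr : (2 * d : ℝ) ≤ m := by exact_mod_cast hdm
  have hz0 : (0 : ℝ) ≤ d * z := by positivity
  rw [freeProb_eq_prod]
  refine (abs_prod_sub_pow_le (c := 2 * (d / m)) ?_ ?_ d fun k hk => ?_).trans (le_of_eq ?_)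
  · rw [sub_nonneg]
    exact div_le_one_of_le₀ hzr hm0.le
  · have : 0 ≤ (d * z : ℝ) / m := by positivity
    linarith
  · have hkd : (k : ℝ) + 1 ≤ d := by exact_mod_cast hk
    have hk0 : (0 : ℝ) ≤ k := by positivity
    have hmk : ((m - k : ℕ) : ℝ) = m - k := by
      rw [Nat.cast_sub (by omega)]
    have hpos : (0 : ℝ) < m - k := by linarith
    refine ⟨by positivity, ?_, ?_⟩
    · refine div_le_one_of_le₀ ?_ (by positivity)
      exact_mod_cast Nat.sub_le_sub_right (Nat.sub_le _ _) _
    · rw [hmk]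
      have e1 : 1 - (d * z : ℝ) / m = (m - d * z) / m := by field_simp
      rw [e1, div_sub_div _ _ hpos.ne' hm0.ne', abs_div, abs_of_pos (mul_pos hpos hm0),
        div_le_iff₀ (by positivity)]
      have e2 : 2 * ((d : ℝ) / m) * ((m - k) * m) = 2 * d * (m - k) := by field_simp
      rw [e2]
      -- In the second case the truncated numerator is zero, and `m - d z ≤ k` makes the target `1 -
      -- d z / m` itself small.
      rcases le_total k (m - d * z) with h | h
      · rw [Nat.cast_sub h, Nat.cast_sub hz]
        push_cast
        have e3 : ((m : ℝ) - d * z - k) * m - (m - k) * (m - d * z) = -(k * (d * z)) := by ring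
        rw [e3, abs_neg, abs_of_nonneg (by positivity)]
        nlinarith [mul_le_mul (by linarith : (k : ℝ) ≤ d) hzr hz0 (by positivity)]
      · rw [Nat.sub_eq_zero_of_le h]
        have h' : (m : ℝ) - d * z ≤ k := by
          have : ((m - d * z : ℕ) : ℝ) ≤ k := by exact_mod_cast h
          rwa [Nat.cast_sub hz, Nat.cast_mul] at this
        rw [Nat.cast_zero, zero_mul, zero_sub, abs_neg, abs_of_nonneg
          (mul_nonneg hpos.le (by linarith))]
        nlinarith
  · ring

/-! ### Gronwall comparison with the limit -/

lemma discrete_gronwall_sum {D : ℕ → ℝ} {A L : ℝ} (hL : 0 ≤ L) (n : ℕ)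
    (h : ∀ k ≤ n, D k ≤ A + L * ∑ j ∈ Finset.range k, D j) : ∀ k ≤ n, D k ≤ A * (1 + L) ^ k := by
  -- The induction runs on the majorant, so neither `D` nor `A` needs a sign.
  have key : ∀ k ≤ n, A + L * ∑ j ∈ Finset.range k, D j ≤ A * (1 + L) ^ k := by
    intro k
    induction k with
    | zero => simp
    | succ k ih =>
      intro hk
      have h1 := ih (by omega)
      have h2 := mul_le_mul_of_nonneg_left ((h k (by omega)).trans h1) hL
      rw [Finset.sum_range_succ, pow_succ]
      linarith
  exact fun k hk => (h k hk).trans (key k hk)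

/-- A path that follows the drift `freeProb` up to an error `c` stays close to the limit. -/
lemma abs_sub_limitTaken_le {m d n : ℕ} (hd : 1 ≤ d) (hm : 2 * d ^ 2 ≤ m) (Z : ℕ → ℕ)
    (hZ : ∀ k, d * Z k ≤ m) {c : ℝ}
    (hc : ∀ k ≤ n, |(Z k : ℝ) - ∑ j ∈ Finset.range k, freeProb m d (Z j)| ≤ c) :
    |(Z n : ℝ) - limitTaken m d n| ≤
      (c + 3 * (n * (d : ℝ) ^ 2 / m)) * Real.exp (n * (d : ℝ) ^ 2 / m) := by
  have hm1 : 0 < m := by nlinarith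
  have hm0 : (0 : ℝ) < m := by exact_mod_cast hm1
  have hd0 : (0 : ℝ) < d := by exact_mod_cast hd
  have hc0 : 0 ≤ c := (abs_nonneg _).trans (hc 0 (Nat.zero_le n))
  set L : ℝ := (d : ℝ) ^ 2 / m with hLdef
  have hL : 0 ≤ L := by positivity
  have hsum : ∀ k : ℕ, limitTaken m d k =
      ∑ j ∈ Finset.range k, (limitTaken m d (j + 1) - limitTaken m d j) := by
    intro k
    induction k with
    | zero => simp [limitTaken_zero]
    | succ k ih =>
      rw [Finset.sum_range_succ, ← ih]
      push_cast
      ring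
  -- Of `3 * L`, two come from approximating `freeProb` by a power and one from the unit time step
  -- of the limit.
  have hstep : ∀ j : ℕ, |freeProb m d (Z j) - (limitTaken m d (j + 1) - limitTaken m d j)| ≤
      3 * L + L * |(Z j : ℝ) - limitTaken m d j| := by
    intro j
    have hj : (0 : ℝ) ≤ j := Nat.cast_nonneg j
    have a1 := abs_freeProb_sub_le hd hm (hZ j)
    have a2 := (limitTaken_step hm1 hd hj).2.2
    have hzr : (d * Z j : ℝ) ≤ m := by exact_mod_cast hZ j
    have a3 := abs_pow_sub_pow_le_mul (a := 1 - (d * Z j : ℝ) / m) (b := uncovered m d j)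
      (sub_nonneg.2 (div_le_one_of_le₀ hzr hm0.le))
      (by have : 0 ≤ (d * Z j : ℝ) / m := by positivity
          linarith) (uncovered_pos hd hj).le (uncovered_le_one hd hj) d
    have e : (d : ℝ) * |1 - (d * Z j : ℝ) / m - uncovered m d j| =
        L * |(Z j : ℝ) - limitTaken m d j| := by
      have : 1 - (d * Z j : ℝ) / m - uncovered m d j =
          -((d / m) * ((Z j : ℝ) - limitTaken m d j)) := by
        unfold limitTaken
        field_simp
        ring
      rw [this, abs_neg, abs_mul, abs_of_pos (by positivity : (0 : ℝ) < d / m), hLdef]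
      ring
    rw [e] at a3
    have tri : freeProb m d (Z j) - (limitTaken m d (j + 1) - limitTaken m d j) =
        (freeProb m d (Z j) - (1 - (d * Z j : ℝ) / m) ^ d) +
        ((1 - (d * Z j : ℝ) / m) ^ d - uncovered m d j ^ d) -
        (limitTaken m d (j + 1) - limitTaken m d j - uncovered m d j ^ d) := by ring
    rw [tri]
    refine (abs_sub _ _).trans ?_
    linarith [abs_add_le (freeProb m d (Z j) - (1 - (d * Z j : ℝ) / m) ^ d)
      ((1 - (d * Z j : ℝ) / m) ^ d - uncovered m d j ^ d)]
  have hG := discrete_gronwall_sum (D := fun k => |(Z k : ℝ) - limitTaken m d k|)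
    (A := c + 3 * (n * L)) hL n (fun k hk => ?_) n le_rfl
  · refine hG.trans ?_
    have e : (n : ℝ) * (d : ℝ) ^ 2 / m = n * L := by rw [hLdef]; ring
    rw [e]
    refine mul_le_mul_of_nonneg_left ?_ (by positivity)
    rw [Real.exp_nat_mul]
    exact pow_le_pow_left₀ (by positivity) (by linarith [Real.add_one_le_exp L]) n
  · have e : (Z k : ℝ) - limitTaken m d k =
        ((Z k : ℝ) - ∑ j ∈ Finset.range k, freeProb m d (Z j)) +
        ∑ j ∈ Finset.range k,
          (freeProb m d (Z j) - (limitTaken m d (j + 1) - limitTaken m d j)) := by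
      rw [Finset.sum_sub_distrib, ← hsum k]
      ring
    rw [e]
    refine (abs_add_le _ _).trans ?_
    have h1 := (Finset.abs_sum_le_sum_abs (fun j : ℕ => freeProb m d (Z j) -
      (limitTaken m d (j + 1) - limitTaken m d j)) (Finset.range k)).trans
      (Finset.sum_le_sum fun j _ => hstep j)
    rw [Finset.sum_add_distrib, Finset.sum_const, Finset.card_range, nsmul_eq_mul,
      ← Finset.mul_sum] at h1
    have h2 : (k : ℝ) * (3 * L) ≤ n * (3 * L) := by
      have : (k : ℝ) ≤ n := by exact_mod_cast hk
      gcongr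
    linarith [hc k hk]

/-- With the trivial bound where the drift error dominates, the deviation is as claimed. -/
lemma abs_sub_estimateGen_le {m d n : ℕ} (hn : 1 ≤ n) (hd : 1 ≤ d) (hm : 2 * d ^ 2 ≤ m)
    (Z : ℕ → ℕ) (hZ : ∀ k, d * Z k ≤ m) (hZn : Z n ≤ n)
    (hc : ∀ k ≤ n, |(Z k : ℝ) - ∑ j ∈ Finset.range k, freeProb m d (Z j)| ≤
      Real.sqrt (8 * n * Real.log (2 * n))) :
    |(Z n : ℝ) - estimateGen n m d| ≤ 3 * Real.exp ((n : ℝ) * (d : ℝ) ^ 2 / m) *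
      Real.sqrt (8 * n * Real.log (2 * n)) := by
  have hm1 : 0 < m := by nlinarith
  have h := abs_sub_limitTaken_le hd hm Z hZ hc
  rw [estimateGen_eq, ← limitTaken]
  set K : ℝ := (n : ℝ) * (d : ℝ) ^ 2 / m
  have hn1 : (1 : ℝ) ≤ n := by exact_mod_cast hn
  have hlog : 0.69 ≤ Real.log (2 * n) := by
    refine le_trans ?_ (Real.log_le_log (by norm_num : (0 : ℝ) < 2)
      (by linarith : (2 : ℝ) ≤ 2 * n))
    linarith [Real.log_two_gt_d9]
  have hX : 8 * n * 0.69 ≤ 8 * n * Real.log (2 * n) := by gcongr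
  have hX0 : 0 ≤ 8 * n * Real.log (2 * n) := by nlinarith
  have hs := Real.sq_sqrt hX0
  set s := Real.sqrt (8 * n * Real.log (2 * n))
  have hs0 : 0 ≤ s := Real.sqrt_nonneg _
  have hs1 : 1 ≤ s := by nlinarith
  have hK0 : 0 ≤ K := by positivity
  by_cases hK : 3 * K ≤ 2 * s
  · refine h.trans ?_
    have := mul_le_mul_of_nonneg_right (by linarith : s + 3 * K ≤ 3 * s) (Real.exp_pos K).le
    linarith
  · have hb := limitTaken_mem hm1 hd n
    have hZr : (Z n : ℝ) ≤ n := by exact_mod_cast hZn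
    have hZ0 : (0 : ℝ) ≤ Z n := Nat.cast_nonneg _
    have h1 : |(Z n : ℝ) - limitTaken m d n| ≤ n := by
      rw [abs_le]
      constructor <;> linarith [hb.1, hb.2]
    refine h1.trans ?_
    -- Here `K > 2s/3`, so `e^K ≥ K²/2 ≥ 2s²/9 ≥ (16 · 0.69 / 9) n ≥ n`.
    have h2 := Real.quadratic_le_exp_of_nonneg hK0
    have h3 : 4 * s ^ 2 ≤ 9 * K ^ 2 := by nlinarith
    have h4 : (n : ℝ) ≤ Real.exp K := by linarith
    have h5 : Real.exp K * 1 ≤ Real.exp K * s := by gcongr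
    have := (Real.exp_pos K).le
    linarith

/-! ### Counting on regular graphs and concentration -/

variable {n m : ℕ}

/-- The left-regular graphs of degree `d`. -/
def regularGraphs (n m d : ℕ) : Finset (BipGraph n m) :=
  Fintype.piFinset fun _ => Finset.powersetCard d Finset.univ

lemma mem_regularGraphs {d : ℕ} {B : BipGraph n m} :
    B ∈ regularGraphs n m d ↔ ∀ u, (B u).card = d := by
  simp [regularGraphs, Fintype.mem_piFinset, Finset.mem_powersetCard]

lemma genR_const_eq (n m d : ℕ) :
    genR n m (fun _ => d) = uniformOn (regularGraphs n m d : Set (BipGraph n m)) := by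
  rw [genR, ← uniformOn_pi]
  congr 1
  ext B
  simp [mem_regularGraphs]

/-- Resampling one neighborhood does not change the law. -/
lemma sum_sum_update (n m d : ℕ) (i : Fin n) (h : BipGraph n m → ℝ) :
    ∑ B ∈ regularGraphs n m d, ∑ a ∈ Finset.powersetCard d (Finset.univ : Finset (Fin m)),
      h (Function.update B i a) = m.choose d * ∑ B ∈ regularGraphs n m d, h B := by
  have hr : (m.choose d : ℝ) * ∑ B ∈ regularGraphs n m d, h B =
      ∑ B ∈ regularGraphs n m d, ∑ _a ∈ Finset.powersetCard d (Finset.univ : Finset (Fin m)),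
        h B := by
    simp [Finset.mul_sum]
  rw [hr, ← Finset.sum_product', ← Finset.sum_product']
  have hmem : ∀ x ∈ regularGraphs n m d ×ˢ Finset.powersetCard d (Finset.univ : Finset (Fin m)),
      (Function.update x.1 i x.2, x.1 i) ∈
        regularGraphs n m d ×ˢ Finset.powersetCard d (Finset.univ : Finset (Fin m)) := by
    rintro ⟨B, a⟩ hx
    simp only [Finset.mem_product, mem_regularGraphs, Finset.mem_powersetCard] at hx ⊢
    refine ⟨fun u => ?_, Finset.subset_univ _, hx.1 i⟩
    by_cases hu : u = i
    · subst hu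
      simpa using hx.2.2
    · simpa [hu] using hx.1 u
  -- Swapping the `i`-th neighborhood with the fresh sample is an involution of the product.
  refine Finset.sum_bij' (fun x _ => (Function.update x.1 i x.2, x.1 i))
    (fun x _ => (Function.update x.1 i x.2, x.1 i)) hmem hmem ?_ ?_ ?_ <;>
  · rintro ⟨B, a⟩ -
    simp

/-- The martingale part of the number of nodes taken by the scan. -/
noncomputable def fluctuation (d : ℕ) (B : BipGraph n m) (k : ℕ) : ℝ :=
  ((scan B k).card : ℝ) - ∑ j ∈ Finset.range k, freeProb m d (scan B j).card

/-- Hoeffding's argument: the centered indicator lies in `[-1, 1]`, convexity bounds the exponential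
by a chord, and the linear term averages to zero. -/
lemma sum_exp_bernoulli_le {α : Type*} (P : Finset α) (A : α → Prop) [DecidablePred A] {p : ℝ}
    (hp0 : 0 ≤ p) (hp1 : p ≤ 1) (hp : ((P.filter A).card : ℝ) = p * P.card) (s : ℝ) :
    ∑ a ∈ P, Real.exp (s * ((if A a then 1 else 0) - p)) ≤ P.card * Real.exp (s ^ 2 / 2) := by
  have h1 : ∀ a ∈ P, Real.exp (s * ((if A a then 1 else 0) - p)) ≤
      Real.cosh s + ((if A a then 1 else 0) - p) * Real.sinh s := by
    intro a _
    rw [mul_comm s]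
    refine Real.exp_mul_le_cosh_add_mul_sinh ?_ s
    split_ifs <;> rw [abs_le] <;> constructor <;> linarith
  refine (Finset.sum_le_sum h1).trans ?_
  rw [Finset.sum_add_distrib, ← Finset.sum_mul, Finset.sum_sub_distrib, Finset.sum_boole, hp]
  simp only [Finset.sum_const, nsmul_eq_mul]
  have := Real.cosh_le_exp_half_sq s
  have h2 : (P.card : ℝ) * Real.cosh s ≤ P.card * Real.exp (s ^ 2 / 2) := by gcongr
  linarith

lemma card_filter_disjoint (m d : ℕ) (C : Finset (Fin m)) :
    ((Finset.powersetCard d Finset.univ).filter fun a => Disjoint a C).card =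
      (m - C.card).choose d := by
  have : (Finset.powersetCard d Finset.univ).filter (fun a => Disjoint a C) =
      Finset.powersetCard d Cᶜ := by
    ext a
    simp [Finset.mem_powersetCard, Finset.subset_compl_iff_disjoint_right, and_comm]
  rw [this, Finset.card_powersetCard, Finset.card_compl, Fintype.card_fin]

lemma fluctuation_update_succ {d : ℕ} (B : BipGraph n m) {i : ℕ} (hi : i < n)
    (a : Finset (Fin m)) :
    fluctuation d (Function.update B ⟨i, hi⟩ a) (i + 1) = fluctuation d B i +
      ((if Disjoint a (neighbors B (scan B i)) then 1 else 0) -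
        freeProb m d (scan B i).card) := by
  have hc : ∀ j ≤ i, scan (Function.update B ⟨i, hi⟩ a) j = scan B j ∧
      neighbors (Function.update B ⟨i, hi⟩ a) (scan (Function.update B ⟨i, hi⟩ a) j) =
        neighbors B (scan B j) := fun j hj => scan_congr j fun u hu => by
    rw [Function.update_of_ne]
    rintro rfl
    exact absurd (hu.trans_le hj) (lt_irrefl _)
  have hsum : ∑ j ∈ Finset.range i, freeProb m d (scan (Function.update B ⟨i, hi⟩ a) j).card =
      ∑ j ∈ Finset.range i, freeProb m d (scan B j).card :=
    Finset.sum_congr rfl fun j hj => by rw [(hc j (Finset.mem_range.1 hj).le).1]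
  have hn : (⟨i, hi⟩ : Fin n) ∉ scan B i :=
    fun h' => absurd (lt_of_mem_scan B i h') (lt_irrefl _)
  rw [fluctuation, fluctuation, Finset.sum_range_succ, hsum, scan_succ _ hi, (hc i le_rfl).2,
    (hc i le_rfl).1, Function.update_self]
  split_ifs with h
  · rw [Finset.card_insert_of_notMem hn]
    push_cast
    ring
  · ring

/-- Averaging over a resampled `i`-th neighborhood plays the role of conditioning on the past; each
step contributes a factor `exp (s² / 2)`. -/
lemma sum_exp_fluctuation_le {d : ℕ} (hdm : d ≤ m) (s : ℝ) (k : ℕ) (hk : k ≤ n) :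
    ∑ B ∈ regularGraphs n m d, Real.exp (s * fluctuation d B k) ≤
      (regularGraphs n m d).card * Real.exp (s ^ 2 / 2 * k) := by
  induction k with
  | zero => simp [fluctuation, scan]
  | succ i ih =>
    have hi : i < n := hk
    have hN : (0 : ℝ) < m.choose d := by exact_mod_cast Nat.choose_pos hdm
    refine le_of_mul_le_mul_left ?_ hN
    rw [← sum_sum_update n m d ⟨i, hi⟩ fun B => Real.exp (s * fluctuation d B (i + 1))]
    have hB : ∀ B ∈ regularGraphs n m d,
        ∑ a ∈ Finset.powersetCard d (Finset.univ : Finset (Fin m)),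
          Real.exp (s * fluctuation d (Function.update B ⟨i, hi⟩ a) (i + 1)) ≤
        Real.exp (s * fluctuation d B i) * (m.choose d * Real.exp (s ^ 2 / 2)) := by
      intro B hB
      simp only [fluctuation_update_succ B hi, mul_add, Real.exp_add]
      rw [← Finset.mul_sum]
      refine mul_le_mul_of_nonneg_left ?_ (Real.exp_pos _).le
      refine (sum_exp_bernoulli_le _ _ (freeProb_nonneg _ _ _) (freeProb_le_one _ _ _) ?_
        s).trans (le_of_eq ?_)
      · rw [card_filter_disjoint, card_neighbors_scan (mem_regularGraphs.1 hB), freeProb,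
          Finset.card_powersetCard, Finset.card_univ, Fintype.card_fin, div_mul_cancel₀ _ hN.ne']
      · rw [Finset.card_powersetCard, Finset.card_univ, Fintype.card_fin]
    refine (Finset.sum_le_sum hB).trans ?_
    rw [← Finset.sum_mul]
    have h := mul_le_mul_of_nonneg_right (ih hi.le)
      (by positivity : 0 ≤ m.choose d * Real.exp (s ^ 2 / 2))
    refine h.trans (le_of_eq ?_)
    have e : s ^ 2 / 2 * ((i + 1 : ℕ) : ℝ) = s ^ 2 / 2 * i + s ^ 2 / 2 := by
      push_cast
      ring
    rw [e, Real.exp_add]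
    ring

/-- Markov's inequality for `exp X`, in counting form. -/
lemma card_le_of_sum_exp_le {α : Type*} (Ω : Finset α) (X : α → ℝ) {c v : ℝ}
    (h : ∑ x ∈ Ω, Real.exp (X x) ≤ Ω.card * Real.exp v) :
    ((Ω.filter fun x => c ≤ X x).card : ℝ) ≤ Ω.card * Real.exp (v - c) := by
  have h1 : ((Ω.filter fun x => c ≤ X x).card : ℝ) * Real.exp c ≤ Ω.card * Real.exp v := by
    refine le_trans ?_ h
    rw [← nsmul_eq_mul]
    refine (Finset.card_nsmul_le_sum _ (fun x => Real.exp (X x)) _ fun x hx =>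
      Real.exp_le_exp.2 (Finset.mem_filter.1 hx).2).trans ?_
    exact Finset.sum_le_sum_of_subset_of_nonneg (Finset.filter_subset _ _) fun _ _ _ =>
      (Real.exp_pos _).le
  rw [Real.exp_sub, ← mul_div_assoc]
  rwa [le_div_iff₀ (Real.exp_pos c)]

/-- Azuma's inequality for the fluctuation at a fixed time. -/
lemma card_lt_abs_fluctuation_le {d : ℕ} (hn : 1 ≤ n) (hdm : d ≤ m) {c : ℝ} (hc : 0 ≤ c) {k : ℕ}
    (hk : k ≤ n) :
    (((regularGraphs n m d).filter fun B => c < |fluctuation d B k|).card : ℝ) ≤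
      2 * ((regularGraphs n m d).card * Real.exp (-(c ^ 2 / (2 * n)))) := by
  have hn0 : (0 : ℝ) < n := by exact_mod_cast hn
  have hkn : (k : ℝ) ≤ n := by exact_mod_cast hk
  -- The choice `s = ±c/n` minimizes the Chernoff exponent `s² n / 2 - |s| c`.
  have tail : ∀ s : ℝ, s ^ 2 = (c / n) ^ 2 →
      (((regularGraphs n m d).filter fun B => c ^ 2 / n ≤ s * fluctuation d B k).card : ℝ) ≤
        (regularGraphs n m d).card * Real.exp (-(c ^ 2 / (2 * n))) := by
    intro s hs
    refine (card_le_of_sum_exp_le _ _ (sum_exp_fluctuation_le hdm s k hk)).trans ?_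
    gcongr
    have : s ^ 2 / 2 * k ≤ s ^ 2 / 2 * n := by gcongr
    have e : s ^ 2 / 2 * n - c ^ 2 / n = -(c ^ 2 / (2 * n)) := by
      rw [hs]
      field_simp
      ring
    linarith
  have hsub : (regularGraphs n m d).filter (fun B => c < |fluctuation d B k|) ⊆
      (regularGraphs n m d).filter (fun B => c ^ 2 / n ≤ c / n * fluctuation d B k) ∪
      (regularGraphs n m d).filter (fun B => c ^ 2 / n ≤ -(c / n) * fluctuation d B k) := by
    intro B hB
    rw [Finset.mem_filter] at hB
    rw [Finset.mem_union, Finset.mem_filter, Finset.mem_filter]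
    have e : c ^ 2 / n = c / n * c := by ring
    have hcn : 0 ≤ c / n := by positivity
    rcases lt_abs.1 hB.2 with h | h
    · refine Or.inl ⟨hB.1, ?_⟩
      rw [e]
      gcongr
    · refine Or.inr ⟨hB.1, ?_⟩
      rw [e, neg_mul, ← mul_neg]
      gcongr
  have h1 : (((regularGraphs n m d).filter fun B => c < |fluctuation d B k|).card : ℝ) ≤ _ :=
    Nat.cast_le.2 ((Finset.card_le_card hsub).trans (Finset.card_union_le _ _))
  push_cast at h1
  linarith [tail (c / n) rfl, tail (-(c / n)) (neg_sq _)]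

/-- Union bound over `1 ≤ k ≤ n` (the fluctuation vanishes at `0`): the choice of `c` makes each
tail at most `2 (2n)⁻⁴`, and `2n (2n)⁻⁴ ≤ 1/n`. -/
lemma card_exists_lt_abs_fluctuation_le {d : ℕ} (hn : 1 ≤ n) (hdm : d ≤ m) :
    (((regularGraphs n m d).filter fun B => ∃ k ≤ n,
      Real.sqrt (8 * n * Real.log (2 * n)) < |fluctuation d B k|).card : ℝ) ≤
      (regularGraphs n m d).card * (1 / n) := by
  have hn1 : (1 : ℝ) ≤ n := by exact_mod_cast hn
  have hlog : 0 ≤ Real.log (2 * n) := Real.log_nonneg (by linarith)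
  set c := Real.sqrt (8 * n * Real.log (2 * n)) with hcdef
  have hc0 : 0 ≤ c := Real.sqrt_nonneg _
  have hsub : (regularGraphs n m d).filter (fun B => ∃ k ≤ n, c < |fluctuation d B k|) ⊆
      (Finset.Icc 1 n).biUnion fun k =>
        (regularGraphs n m d).filter fun B => c < |fluctuation d B k| := by
    intro B hB
    obtain ⟨hB, k, hk, h⟩ := Finset.mem_filter.1 hB
    refine Finset.mem_biUnion.2 ⟨k, Finset.mem_Icc.2 ⟨?_, hk⟩, Finset.mem_filter.2 ⟨hB, h⟩⟩
    rcases Nat.eq_zero_or_pos k with rfl | hk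
    · simp only [fluctuation, scan, Finset.card_empty, Nat.cast_zero, Finset.range_zero,
        Finset.sum_empty, sub_zero, abs_zero] at h
      exact absurd h hc0.not_gt
    · exact hk
  have h1 : (((regularGraphs n m d).filter fun B => ∃ k ≤ n, c < |fluctuation d B k|).card : ℝ)
      ≤ _ := Nat.cast_le.2 ((Finset.card_le_card hsub).trans Finset.card_biUnion_le)
  refine h1.trans ?_
  push_cast
  refine (Finset.sum_le_sum fun k hk => card_lt_abs_fluctuation_le hn hdm hc0
    (Finset.mem_Icc.1 hk).2).trans ?_
  have e : Real.exp (-(c ^ 2 / (2 * n))) = ((2 * n : ℝ) ^ 4)⁻¹ := by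
    have : c ^ 2 / (2 * n) = (4 : ℕ) * Real.log (2 * n) := by
      rw [hcdef, Real.sq_sqrt (by positivity)]
      push_cast
      field_simp
      ring
    rw [Real.exp_neg, this, Real.exp_nat_mul, Real.exp_log (by linarith)]
  rw [Finset.sum_const, Nat.card_Icc, Nat.add_sub_cancel, nsmul_eq_mul, e]
  have h2 : (n : ℝ) * (2 * (2 * n : ℝ) ^ 4)⁻¹ * 4 ≤ 1 / n := by
    rw [le_div_iff₀ (by linarith)]
    field_simp
    nlinarith [one_le_pow₀ hn1 (n := 2)]
  have h3 := mul_le_mul_of_nonneg_left h2 (Nat.cast_nonneg (α := ℝ) (regularGraphs n m d).card)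
  refine le_trans (le_of_eq ?_) h3
  field_simp
  ring

/-- The last full iteration is close to the estimate with high probability. -/
theorem one_sub_le_genR_abs_lastFullStep_sub_le {n m d : ℕ} (hn : 1 ≤ n)
    (hd : 1 ≤ d) (hm : 2 * d ^ 2 ≤ m) :
    1 - 1 / (n : ℝ) ≤ (genR n m fun _ => d).real
      {B | |(lastFullStep B d : ℝ) - estimateGen n m d| ≤
        3 * Real.exp ((n : ℝ) * (d : ℝ) ^ 2 / m) * Real.sqrt (8 * n * Real.log (2 * n))} := by
  have hdm : d ≤ m := by nlinarith
  have hpos : 0 < (regularGraphs n m d).card := by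
    rw [regularGraphs, Fintype.card_piFinset]
    refine Finset.prod_pos fun _ _ => ?_
    simpa using Nat.choose_pos hdm
  have hne : (regularGraphs n m d).Nonempty := Finset.card_pos.1 hpos
  have : IsProbabilityMeasure (uniformOn (regularGraphs n m d : Set (BipGraph n m))) :=
    isProbabilityMeasure_uniformOn (Finset.finite_toSet _) hne
  classical
  set bad := (regularGraphs n m d).filter fun B => ∃ k ≤ n,
      Real.sqrt (8 * n * Real.log (2 * n)) < |fluctuation d B k| with hbad
  have hcard := card_exists_lt_abs_fluctuation_le (d := d) hn hdm
  rw [← hbad] at hcard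
  have hposr : (0 : ℝ) < (regularGraphs n m d).card := by exact_mod_cast hpos
  have hgood : ((regularGraphs n m d \ bad : Finset (BipGraph n m)) : Set (BipGraph n m)) ⊆
      {B | |(lastFullStep B d : ℝ) - estimateGen n m d| ≤
        3 * Real.exp ((n : ℝ) * (d : ℝ) ^ 2 / m) * Real.sqrt (8 * n * Real.log (2 * n))} := by
    intro B hB
    obtain ⟨hB, hnb⟩ := Finset.mem_sdiff.1 (Finset.mem_coe.1 hB)
    have hreg := mem_regularGraphs.1 hB
    have hfl : ∀ k ≤ n, |fluctuation d B k| ≤ Real.sqrt (8 * n * Real.log (2 * n)) := by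
      intro k hk
      by_contra h
      exact hnb (Finset.mem_filter.2 ⟨hB, k, hk, not_le.1 h⟩)
    rw [Set.mem_ofPred_eq, lastFullStep_eq_card_scan hd hreg]
    refine abs_sub_estimateGen_le hn hd hm (fun k => (scan B k).card) (fun k => ?_) ?_ hfl
    · rw [← card_neighbors_scan hreg]
      exact (Finset.card_le_univ _).trans (by simp)
    · exact (Finset.card_le_univ _).trans (by simp)
  rw [genR_const_eq]
  refine le_trans ?_ (measureReal_mono hgood)
  rw [Measure.real, uniformOn_apply_finset,
    Finset.inter_eq_right.2 Finset.sdiff_subset, ENNReal.toReal_div, ENNReal.toReal_natCast,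
    ENNReal.toReal_natCast, Finset.card_sdiff_of_subset (Finset.filter_subset _ _),
    Nat.cast_sub (Finset.card_le_card (Finset.filter_subset _ _)), le_div_iff₀ hposr]
  linarith

end MaxCoverage

theorem mainTheorem5 :
    (∀ n d : ℕ, 1 ≤ d → (d : ℝ) ≤ Real.sqrt ((n : ℝ) / 2) →
      1 - 1 / (n : ℝ) ≤ (MaxCoverage.lrr n d).real
        {B | |(MaxCoverage.lastFullStep B d : ℝ) - MaxCoverage.estimate n d| ≤
          3 * Real.exp ((d : ℝ) ^ 2) * Real.sqrt (8 * n * Real.log (2 * n))}) ∧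
    (∀ n m d : ℕ, 1 ≤ n → 1 ≤ d → 2 * d ^ 2 ≤ m →
      1 - 1 / (n : ℝ) ≤ (MaxCoverage.genR n m fun _ => d).real
        {B | |(MaxCoverage.lastFullStep B d : ℝ) - MaxCoverage.estimateGen n m d| ≤
          3 * Real.exp ((n : ℝ) * (d : ℝ) ^ 2 / m) *
            Real.sqrt (8 * n * Real.log (2 * n))}) := by
  refine ⟨fun n d hd hdn => ?_, fun n m d hn hd hm => MaxCoverage.one_sub_le_genR_abs_lastFullStep_sub_le hn hd hm⟩
  have hd0 : (0 : ℝ) < d := by exact_mod_cast hd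
  have hsq : (d : ℝ) ^ 2 ≤ n / 2 := (Real.le_sqrt' hd0).1 hdn
  have hm : 2 * d ^ 2 ≤ n := by
    have : (2 * d ^ 2 : ℝ) ≤ n := by linarith
    exact_mod_cast this
  have hn : 1 ≤ n := by nlinarith
  have hn0 : (n : ℝ) ≠ 0 := by positivity
  have h := MaxCoverage.one_sub_le_genR_abs_lastFullStep_sub_le hn hd hm
  have e1 : (n : ℝ) * (d : ℝ) ^ 2 / n = (d : ℝ) ^ 2 := by field_simp
  have e2 : MaxCoverage.estimateGen n n d = MaxCoverage.estimate n d := by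
    unfold MaxCoverage.estimateGen MaxCoverage.estimate
    rw [div_self hn0]
    have e3 : (n : ℝ) * d * (d - 1) / n = d * (d - 1) := by field_simp
    rw [e3]
  rw [e1, e2] at h
  exact h
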